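/- Theorem 1.2. Let $p$ be a prime with $p \equiv 1 \pmod 4$, and let $b \in \mathbb{Z}$ satisfy $\left(\frac{b^2-4}{p}\right) = -1$, where $\left(\frac{\cdot}{p}\right)$ denotes the Legendre symbol. For $b, c \in \mathbb{Z}$ let $D_p(b,c) = \det\left[(i^2+bij+cj^2)^{p-2}\right]_{1\le i,j\le p-1}$. Then $$\left(\frac{D_p(b,1)}{p}\right) = \left(\frac{2b}{p}\right).$$ -/

import Mathlib

/-- The integer determinant `D_p(b,c) = |(i² + b i j + c j²)^(p-2)|` for `1 ≤ i, j ≤ p - 1`.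
The index type `Fin (p - 1)` runs over `0, …, p - 2`, so the row and column labels are
`i + 1` and `j + 1`. -/
def sunDet (p : ℕ) (b c : ℤ) : ℤ :=
  Matrix.det (Matrix.of fun i j : Fin (p - 1) =>
    ((((i : ℕ) : ℤ) + 1) ^ 2 + b * (((i : ℕ) : ℤ) + 1) * (((j : ℕ) : ℤ) + 1)
      + c * (((j : ℕ) : ℤ) + 1) ^ 2) ^ (p - 2))

/-! Modulo `p` each entry is the inverse of a nonvanishing quadratic form. For `t ≠ 0`, the inverse
of `t² + bt + 1` is `(b² - 4)⁻¹ ∑ Vₘ₊₂ tᵐ` over `m < p - 1` (`quadratic_mul_sum_lucasV`). With `t =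
xᵢ/xⱼ` the matrix becomes Vandermonde · diagonal · inverse Vandermonde, up to sign and square column
factors, so its determinant is `V₂ ⋯ Vₚ` times a nonzero square. Since `b² - 4` is a nonresidue, `Vₙ
= Vₚ₊₁₋ₙ`, and pairing leaves only `V₍ₚ₊₁₎⸝₂ = ±2` and `Vₚ = -b` (`prod_lucasV`); the signs are
squares because `p ≡ 1 (mod 4)`. -/

open Polynomial in
/-- The Lucas-type sequence `V₀ = 2`, `V₁ = -b`, `Vₙ₊₂ = -b Vₙ₊₁ - Vₙ`. -/
noncomputable def lucasV {R : Type*} [CommRing R] (b : R) (n : ℕ) : R :=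
  (dickson 1 (1 : R) n).eval (-b)

section Ring

variable {R : Type*} [CommRing R] (b : R)

theorem lucasV_zero : lucasV b 0 = 2 := by
  simp only [lucasV, Polynomial.dickson_zero]
  norm_num

theorem lucasV_one : lucasV b 1 = -b := by simp [lucasV]

theorem lucasV_add_two (n : ℕ) : lucasV b (n + 2) = -b * lucasV b (n + 1) - lucasV b n := by
  simp [lucasV, Polynomial.dickson_add_two]

/-- The recurrence cancels every interior coefficient, leaving boundary terms. -/
theorem mul_sum_lucasV (t : R) (N : ℕ) :
    (t ^ 2 + b * t + 1) * ∑ m ∈ Finset.range N, lucasV b (m + 2) * t ^ m =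
      lucasV b 2 - t * lucasV b 1 - t ^ N * lucasV b (N + 2) + t ^ (N + 1) * lucasV b (N + 1) := by
  induction N with
  | zero => simp
  | succ N ih =>
    rw [Finset.sum_range_succ, mul_add, ih, show N + 1 + 2 = (N + 1) + 2 from rfl,
      lucasV_add_two b (N + 1)]
    ring

end Ring

section Prime

variable {p : ℕ} [Fact p.Prime] {b : ZMod p}

theorem lucasV_prime : lucasV b p = -b := by
  simp [lucasV, Polynomial.dickson_one_one_zmod_p]

theorem two_ne_zero_of_ne_two (hp2 : p ≠ 2) : (2 : ZMod p) ≠ 0 := fun h =>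
  hp2 ((Nat.prime_dvd_prime_iff_eq Fact.out Nat.prime_two).1
    ((ZMod.natCast_eq_zero_iff 2 p).1 (by exact_mod_cast h)))

/-- In the non-split case `Vₙ = αⁿ + α⁻ⁿ` for some `α` of norm one. -/
theorem exists_lucasV_eq_of_isAlgClosed {K : Type*} [Field K] [IsAlgClosed K] (φ : ZMod p →+* K)
    (hp2 : p ≠ 2) (hb : (b ^ 2 - 4) ^ (p / 2) = -1) :
    ∃ α : K, α ^ (p + 1) = 1 ∧ α ≠ 0 ∧ ∀ n, φ (lucasV b n) = α ^ n + α⁻¹ ^ n := by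
  have : CharP K p := charP_of_injective_ringHom φ.injective p
  obtain ⟨α, hα⟩ : ∃ α : K, α ^ 2 + φ b * α + 1 = 0 := by
    obtain ⟨α, hα⟩ := IsAlgClosed.exists_root
      (Polynomial.C 1 * Polynomial.X ^ 2 + Polynomial.C (φ b) * Polynomial.X + Polynomial.C 1 :
        Polynomial K) (by rw [Polynomial.degree_quadratic one_ne_zero]; decide)
    exact ⟨α, by simpa [Polynomial.IsRoot] using hα⟩
  have hα0 : α ≠ 0 := by
    rintro rfl
    simp at hα
  have hsum : φ (-b) = α + α⁻¹ := by
    rw [map_neg]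
    field_simp
    linear_combination -hα
  have hV : ∀ n, φ (lucasV b n) = α ^ n + α⁻¹ ^ n := fun n => by
    rw [← Polynomial.dickson_one_one_eval_add_inv α α⁻¹ (mul_inv_cancel₀ hα0), ← hsum, lucasV,
      ← Polynomial.eval_map_apply, Polynomial.map_dickson, map_one]
  refine ⟨α, ?_, hα0, hV⟩
  have hodd : p = 2 * (p / 2) + 1 := by
    have := (Fact.out : p.Prime).eq_two_or_odd
    omega
  have h1 : α ^ p + α⁻¹ ^ p = α + α⁻¹ := by rw [← hV, lucasV_prime, hsum]
  have hsq : (α - α⁻¹) ^ 2 = φ (b ^ 2 - 4) := by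
    have : φ (b ^ 2 - 4) = (φ (-b)) ^ 2 - 4 := by simp [map_ofNat φ 4]
    rw [this, hsum]
    field_simp
    ring
  -- Frobenius negates a square root of the nonresidue `b² - 4`, hence swaps `α` and `α⁻¹`.
  have h2 : α ^ p - α⁻¹ ^ p = -(α - α⁻¹) := by
    calc α ^ p - α⁻¹ ^ p = (α - α⁻¹) ^ (2 * (p / 2) + 1) := by rw [← hodd, sub_pow_char]
      _ = -(α - α⁻¹) := by rw [pow_succ, pow_mul, hsq, ← map_pow, hb, map_neg, map_one, neg_one_mul]
  have two : (2 : K) ≠ 0 := by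
    simpa only [map_ofNat] using (map_ne_zero φ).2 (two_ne_zero_of_ne_two hp2)
  have h3 : α ^ p = α⁻¹ := mul_left_cancel₀ two (by linear_combination h1 + h2)
  rw [pow_succ, h3, inv_mul_cancel₀ hα0]

theorem lucasV_facts (hp : p % 4 = 1) (hb : (b ^ 2 - 4) ^ (p / 2) = -1) :
    (∀ n m, n + m = p + 1 → lucasV b n = lucasV b m) ∧ (∀ n, lucasV b n ≠ 0) ∧
      lucasV b ((p + 1) / 2) ^ 2 = 4 := by
  have hp2 : p ≠ 2 := by rintro rfl; omega
  obtain ⟨K, _, _, φ⟩ : ∃ (K : Type) (_ : Field K), IsAlgClosed K ∧ Nonempty (ZMod p →+* K) :=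
    ⟨AlgebraicClosure (ZMod p), inferInstance, inferInstance, ⟨algebraMap _ _⟩⟩
  obtain ⟨φ⟩ := φ
  obtain ⟨α, h1, h0, hV⟩ := exists_lucasV_eq_of_isAlgClosed φ hp2 hb
  have inj := φ.injective
  have hinv : ∀ n m, n + m = p + 1 → α⁻¹ ^ n = α ^ m := fun n m h => by
    rw [inv_pow, inv_eq_of_mul_eq_one_right (by rw [← pow_add, h, h1])]
  have hsymm : ∀ n m, n + m = p + 1 → lucasV b n = lucasV b m := fun n m h => inj <| by
    rw [hV, hV, hinv n m h, hinv m n (by omega), add_comm]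
  have two : (2 : K) ≠ 0 := by
    simpa only [map_ofNat] using (map_ne_zero φ).2 (two_ne_zero_of_ne_two hp2)
  refine ⟨hsymm, fun n hn => ?_, inj ?_⟩
  · have h := hV n
    rw [hn, map_zero, inv_pow] at h
    -- A zero `Vₙ` forces `α²ⁿ = -1`; raising this to the odd power `(p + 1) / 2` gives `1 = -1`.
    have h4 : (α ^ n) ^ 2 = -1 := by
      have : α ^ n ≠ 0 := pow_ne_zero _ h0
      field_simp at h
      linear_combination -h
    have h5 : ((α ^ n) ^ 2) ^ ((p + 1) / 2) = 1 := by
      rw [← pow_mul, ← pow_mul, show 2 * ((p + 1) / 2) = p + 1 by omega, mul_comm,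
        pow_mul, h1, one_pow]
    rw [h4, Odd.neg_one_pow (Nat.odd_iff.2 (by omega))] at h5
    exact two (by linear_combination -h5)
  · have h := hinv ((p + 1) / 2) ((p + 1) / 2) (by omega)
    rw [map_pow, hV, h]
    have h6 : (α ^ ((p + 1) / 2)) ^ 2 = 1 := by
      rw [← pow_mul, show (p + 1) / 2 * 2 = p + 1 by omega, h1]
    rw [map_ofNat]
    linear_combination 4 * h6

theorem prod_lucasV (hp : p % 4 = 1) (hb : (b ^ 2 - 4) ^ (p / 2) = -1) :
    ∃ w : ZMod p, w ≠ 0 ∧ ∏ m ∈ Finset.range (p - 1), lucasV b (m + 2) = 2 * b * w ^ 2 := by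
  obtain ⟨hsymm, hne, hmid⟩ := lucasV_facts hp hb
  obtain ⟨i, hi⟩ : IsSquare (-1 : ZMod p) := ZMod.exists_sq_eq_neg_one_iff.2 (by omega)
  have hi0 : i ≠ 0 := by rintro rfl; simp at hi
  obtain ⟨k, hk⟩ : ∃ k, p = 4 * k + 5 := ⟨(p - 5) / 4, by
    have := (Fact.out : p.Prime).two_le
    omega⟩
  set P := ∏ m ∈ Finset.range (2 * k + 1), lucasV b (m + 2)
  have hP : P ≠ 0 := Finset.prod_ne_zero_iff.2 fun m _ => hne _
  have hprod : ∏ m ∈ Finset.range (p - 1), lucasV b (m + 2) =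
      P ^ 2 * lucasV b ((p + 1) / 2) * -b := by
    -- The reflection `n ↦ p + 1 - n` maps the upper half `V₂ₖ₊₄, …, Vₚ₋₁` onto the lower half; `Vₚ`
    -- would pair with `V₁`, which is outside the range.
    have hq : ∏ m ∈ Finset.range (2 * k + 1), lucasV b (2 * k + 2 + m + 2) = P := by
      rw [← Finset.prod_range_reflect]
      refine Finset.prod_congr rfl fun m hm => hsymm _ _ ?_
      have := Finset.mem_range.1 hm
      omega
    rw [show p - 1 = (2 * k + 1 + 1) + (2 * k + 1) + 1 by omega, Finset.prod_range_succ,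
      Finset.prod_range_add, hq, Finset.prod_range_succ,
      show (2 * k + 1 + 1) + (2 * k + 1) + 2 = p by omega, lucasV_prime,
      show 2 * k + 1 + 2 = (p + 1) / 2 by omega]
    ring
  rw [hprod]
  have h : (lucasV b ((p + 1) / 2) - 2) * (lucasV b ((p + 1) / 2) + 2) = 0 := by
    linear_combination hmid
  rcases mul_eq_zero.1 h with h | h
  -- If the middle term is `2`, the product is `-2bP²`, and `i² = -1` absorbs the sign.
  · exact ⟨i * P, mul_ne_zero hi0 hP, by linear_combination -b * P ^ 2 * h + 2 * b * P ^ 2 * hi⟩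
  · exact ⟨P, hP, by linear_combination -b * P ^ 2 * h⟩

theorem quadratic_mul_sum_lucasV (hp : p % 4 = 1) (hb : (b ^ 2 - 4) ^ (p / 2) = -1)
    {t : ZMod p} (ht : t ≠ 0) :
    (t ^ 2 + b * t + 1) * ∑ m ∈ Finset.range (p - 1), lucasV b (m + 2) * t ^ m = b ^ 2 - 4 := by
  obtain ⟨hsymm, -, -⟩ := lucasV_facts hp hb
  have hpos := (Fact.out : p.Prime).two_le
  -- As `tᵖ⁻¹ = 1`, the boundary terms are `V₂ - V₀ + t(Vₚ - V₁)`, and `Vₚ = V₁`.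
  rw [mul_sum_lucasV, pow_succ, ZMod.pow_card_sub_one_eq_one ht,
    show p - 1 + 2 = p + 1 by omega, show p - 1 + 1 = p by omega, hsymm (p + 1) 0 rfl,
    lucasV_prime, lucasV_one, lucasV_zero, lucasV_add_two b 0, zero_add, lucasV_one, lucasV_zero]
  ring

theorem sum_pow_div (x y : ZMod p) (hx : x ≠ 0) (hy : y ≠ 0) :
    ∑ m ∈ Finset.range (p - 1), x ^ m * y⁻¹ ^ m = if x = y then -1 else 0 := by
  simp_rw [← mul_pow]
  split_ifs with h
  · subst h
    simp [mul_inv_cancel₀ hx, Nat.cast_sub (Fact.out : p.Prime).one_le]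
  · have h1 : x * y⁻¹ ≠ 1 := fun h' => h (by
      rw [← div_eq_mul_inv, div_eq_one_iff_eq hy] at h'; exact h')
    rw [geom_sum_eq h1, ZMod.pow_card_sub_one_eq_one (mul_ne_zero hx (inv_ne_zero hy)), sub_self,
      zero_div]

theorem natCast_fin_succ_ne_zero (i : Fin (p - 1)) : ((i : ℕ) : ZMod p) + 1 ≠ 0 := fun h => by
  have h' : p ∣ (i : ℕ) + 1 := (ZMod.natCast_eq_zero_iff _ p).1 (by exact_mod_cast h)
  have := Nat.le_of_dvd (Nat.succ_pos _) h'
  have := i.2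
  omega

theorem natCast_fin_succ_inj (i j : Fin (p - 1)) :
    ((i : ℕ) : ZMod p) + 1 = ((j : ℕ) : ZMod p) + 1 ↔ i = j := by
  refine ⟨fun h => ?_, fun h => by rw [h]⟩
  have h' := (ZMod.natCast_eq_natCast_iff' _ _ p).1 (add_right_cancel h)
  rw [Nat.mod_eq_of_lt (by omega), Nat.mod_eq_of_lt (by omega)] at h'
  exact Fin.ext h'

theorem sunDet_cast (p : ℕ) [Fact p.Prime] (hp : p % 4 = 1) (b : ℤ)
    (hb : ((b : ZMod p) ^ 2 - 4) ^ (p / 2) = -1) :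
    ∃ w : ZMod p, w ≠ 0 ∧ ((sunDet p b 1 : ℤ) : ZMod p) = 2 * b * w ^ 2 := by
  have hpos := (Fact.out : p.Prime).two_le
  set x : Fin (p - 1) → ZMod p := fun i => ((i : ℕ) : ZMod p) + 1
  have hx : ∀ i, x i ≠ 0 := natCast_fin_succ_ne_zero
  set c : ZMod p := (b : ZMod p) ^ 2 - 4
  have hc : c ≠ 0 := by
    intro h
    rw [h, zero_pow (by omega)] at hb
    simp at hb
  set A : Matrix (Fin (p - 1)) (Fin (p - 1)) (ZMod p) := .of fun i m => x i ^ (m : ℕ)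
  set B : Matrix (Fin (p - 1)) (Fin (p - 1)) (ZMod p) := .of fun m j => (x j)⁻¹ ^ (m : ℕ)
  set V : Fin (p - 1) → ZMod p := fun m => c⁻¹ * lucasV (b : ZMod p) ((m : ℕ) + 2)
  -- Orthogonality of the characters of the unit group; `p - 1` equals `-1` in `ZMod p`.
  have hAB : A * B = -1 := by
    ext i j
    simp only [Matrix.mul_apply, A, B, Matrix.of_apply]
    rw [Fin.sum_univ_eq_sum_range (fun m => x i ^ m * (x j)⁻¹ ^ m), sum_pow_div _ _ (hx i) (hx j)]
    simp only [x, natCast_fin_succ_inj, Matrix.neg_apply, Matrix.one_apply]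
    split_ifs <;> simp
  have hdet : A.det * B.det = 1 := by
    rw [← Matrix.det_mul, hAB, Matrix.det_neg, Matrix.det_one, Fintype.card_fin,
      Even.neg_one_pow (Nat.even_iff.2 (by omega)), one_mul]
  have hM : ((sunDet p b 1 : ℤ) : ZMod p) =
      (A * Matrix.diagonal V * B * Matrix.diagonal fun j => (x j)⁻¹ ^ 2).det := by
    rw [sunDet, Int.cast_det]
    congr 1
    ext i j
    rw [Matrix.mul_diagonal, Matrix.mul_apply]
    simp only [Matrix.mul_diagonal, Matrix.map_apply, Matrix.of_apply, A, B, V]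
    have key := quadratic_mul_sum_lucasV hp hb (mul_ne_zero (hx i) (inv_ne_zero (hx j)))
    set S := ∑ m ∈ Finset.range (p - 1), lucasV (b : ZMod p) (m + 2) * (x i * (x j)⁻¹) ^ m with hS
    have hsum : ∑ m : Fin (p - 1), x i ^ (m : ℕ) * (c⁻¹ * lucasV (b : ZMod p) ((m : ℕ) + 2)) *
        (x j)⁻¹ ^ (m : ℕ) = c⁻¹ * S := by
      rw [hS, Fin.sum_univ_eq_sum_range (fun m => x i ^ m * (c⁻¹ * lucasV (b : ZMod p) (m + 2)) *
        (x j)⁻¹ ^ m), Finset.mul_sum]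
      refine Finset.sum_congr rfl fun m _ => ?_
      rw [mul_pow]
      ring
    rw [hsum]
    push_cast
    change (x i ^ 2 + b * x i * x j + 1 * x j ^ 2) ^ (p - 2) = _
    set e := x i ^ 2 + b * x i * x j + 1 * x j ^ 2
    have he : e * (c⁻¹ * S * (x j)⁻¹ ^ 2) = 1 := by
      have : e * (x j)⁻¹ ^ 2 = (x i * (x j)⁻¹) ^ 2 + b * (x i * (x j)⁻¹) + 1 := by
        have := hx j
        simp only [e]
        field_simp
      calc _ = c⁻¹ * (e * (x j)⁻¹ ^ 2 * S) := by ring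
        _ = 1 := by rw [this, key, inv_mul_cancel₀ hc]
    have he0 : e ≠ 0 := left_ne_zero_of_mul_eq_one he
    refine mul_left_cancel₀ he0 ?_
    rw [he, ← pow_succ', show p - 2 + 1 = p - 1 by omega, ZMod.pow_card_sub_one_eq_one he0]
  obtain ⟨w, hw, hprod⟩ := prod_lucasV hp hb
  have hV : ∏ m, V m = 2 * b * w ^ 2 := by
    rw [← hprod, Finset.prod_mul_distrib, Finset.prod_const, Finset.card_univ, Fintype.card_fin,
      ZMod.pow_card_sub_one_eq_one (inv_ne_zero hc), one_mul,
      Fin.prod_univ_eq_prod_range (fun m => lucasV (b : ZMod p) (m + 2))]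
  refine ⟨w * ∏ j, (x j)⁻¹,
    mul_ne_zero hw (Finset.prod_ne_zero_iff.2 fun j _ => inv_ne_zero (hx j)), ?_⟩
  rw [hM, Matrix.det_mul, Matrix.det_mul, Matrix.det_mul, Matrix.det_diagonal,
    Matrix.det_diagonal, hV, Finset.prod_pow]
  linear_combination (2 * b * w ^ 2 * (∏ j, (x j)⁻¹) ^ 2) * hdet

end Prime

theorem theorem1p2 (p : ℕ) [Fact p.Prime] (hp : p % 4 = 1) (b : ℤ)
    (hb : legendreSym p (b ^ 2 - 4) = -1) :
    legendreSym p (sunDet p b 1) = legendreSym p (2 * b) := by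
  have hb' : ((b : ZMod p) ^ 2 - 4) ^ (p / 2) = -1 := by
    have h := legendreSym.eq_pow p (b ^ 2 - 4)
    rw [hb] at h
    push_cast at h
    exact h.symm
  obtain ⟨w, hw, h⟩ := sunDet_cast p hp b hb'
  rw [legendreSym, legendreSym, h, map_mul, quadraticChar_sq_one' hw, mul_one]
  push_cast
  rfl
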